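/- Let $\Bbbk$ be a field with $\operatorname{char}\Bbbk=0$, let $n>0$ be an integer, and let $I=\langle y_1+\cdots+y_n,\;y_1^2,\dots,y_n^2\rangle\subseteq \Bbbk[y_1,\dots,y_n]$. Use the lexicographic monomial order: $y^\alpha>_{lex}y^\beta$ if the leftmost nonzero entry of $\alpha-\beta$ is positive (so $y_1>y_2>\cdots>y_n$). Regard $\alpha\in\{0,1\}^n$ as a northeast lattice path starting at $(0,0)$, where the entry $0$ is a north step and $1$ is an east step, and let $\ell_1(\alpha)$ be the number of entries $1$. A Catalan path is a bitstring $w\in\{0,1\}^{2l}$ ($l\ge 0$) whose path goes from $(0,0)$ to $(l,l)$ and stays weakly above the line $y=x$. A Modified Catalan Path (MCP) is a bitstring $\alpha\in\{0,1\}^n$ of the form $\alpha=w\,1\,0^m$ with $w\in\{0,1\}^{2l}$ a Catalan path and $l,m\ge 0$; the last $1$ of such an $\alpha$ is at position $d=2l+1=2\ell_1(\alpha)-1$. For an MCP $\alpha$ put $$P_\alpha=\{\beta\in\{0,1\}^n:\ \beta\ne\alpha,\ \ell_1(\beta)=\ell_1(\alpha),\ \text{and } \alpha_i=0\Rightarrow\beta_i=0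 \text{ for all } 1\le i\le d\}$$ (these are certain paths weakly above $\alpha$ with the same endpoint as $\alpha$), and $$g_\alpha=y^\alpha+\sum_{\beta\in P_\alpha}y^\beta .$$ Then $I$ has exactly one reduced Gröbner basis with respect to $>_{lex}$ (a finite $G\subseteq I$ whose leading terms generate the ideal of leading terms of $I$, such that each $p\in G$ has leading coefficient $1$ and no monomial of $p$ lies in the ideal generated by the leading terms of $G\setminus\{p\}$), and it is $$\{y_2^2,\dots,y_n^2\}\cup\{g_\alpha:\ \alpha\in\{0,1\}^n\text{ is an MCP}\}.$$ Equivalently, with $F_\ell=\{y_2^2,\dots,y_n^2\}\cup\{g_\alpha:\ \alpha\in\{0,1\}^n\text{ is an MCP and }\ell_1(\alpha)-1\le\ell\}$, the reduced Gröbner basis of $I$ is $F_{\lfloor (n-1)/2\rfloor}$. -/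

import Mathlib

open MvPolynomial

noncomputable section

namespace CatalanGroebner

/-! ### Gröbner bases -/

section Groebner

variable {σ K : Type*} [Field K]

/-- A finite subset `G` of the ideal `I` is a Gröbner basis of `I` if the leading terms of the
elements of `G` generate the ideal spanned by the leading terms of all elements of `I`
(the leading term of `0` is `0`). -/
def IsGroebnerBasis (m : MonomialOrder σ) (I : Ideal (MvPolynomial σ K))
    (G : Set (MvPolynomial σ K)) : Prop :=
  G.Finite ∧ G ⊆ I ∧
    Ideal.span (m.leadingTerm '' G) = Ideal.span (m.leadingTerm '' (I : Set (MvPolynomial σ K)))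

/-- A Gröbner basis is reduced if all its elements `p` have leading coefficient `1` and no monomial
of `p` lies in the ideal generated by the leading terms of the other elements. -/
def IsReducedGroebnerBasis (m : MonomialOrder σ) (I : Ideal (MvPolynomial σ K))
    (G : Set (MvPolynomial σ K)) : Prop :=
  IsGroebnerBasis m I G ∧
    ∀ p ∈ G, m.leadingCoeff p = 1 ∧
      ∀ e ∈ p.support, monomial e (1 : K) ∉ Ideal.span (m.leadingTerm '' (G \ {p}))

end Groebner

/-! ### Paths

A bitstring is a northeast path: `false` (the bit `0`) is a north step, `true` (the bit `1`) is an
east step. -/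

/-- `w` is a Catalan path from `(0,0)` to `(l,l)`: it has `l` north and `l` east steps and, after
any number of steps, it has made at most as many east steps as north steps. -/
def IsCatalanPath (l : ℕ) (w : List Bool) : Prop :=
  w.count false = l ∧ w.count true = l ∧
    ∀ k : ℕ, (w.take k).count true ≤ (w.take k).count false

/-- `α` is a Modified Catalan Path: `α = w 1 0^m` for a Catalan path `w`. -/
def IsMCP {n : ℕ} (α : Fin n → Bool) : Prop :=
  ∃ (l m : ℕ) (w : List Bool), IsCatalanPath l w ∧
    List.ofFn α = w ++ true :: List.replicate m false

/-- The number of entries `1` of a bitstring. -/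
def ones {n : ℕ} (α : Fin n → Bool) : ℕ :=
  (Finset.univ.filter fun i => α i = true).card

/-- `P_α`: the bitstrings `β ≠ α` with as many ones as `α` and such that `α_i = 0` implies
`β_i = 0` for `1 ≤ i ≤ d`, where `d = 2 ℓ₁(α) - 1`. The position of `i : Fin n` is `i + 1`. -/
def pathsAbove {n : ℕ} (α : Fin n → Bool) : Finset (Fin n → Bool) :=
  Finset.univ.filter fun β => β ≠ α ∧ ones β = ones α ∧
    ∀ i : Fin n, (i : ℕ) + 1 ≤ 2 * ones α - 1 → α i = false → β i = false

/-! ### The ideal and the polynomials -/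

section Polynomials

variable (K : Type*) [Field K]

/-- The square-free monomial `y^α` of a bitstring `α`. -/
def bitMonomial {n : ℕ} (α : Fin n → Bool) : MvPolynomial (Fin n) K :=
  ∏ i, X i ^ (α i).toNat

/-- `g_α = y^α + ∑_{β ∈ P_α} y^β`. -/
def gPoly {n : ℕ} (α : Fin n → Bool) : MvPolynomial (Fin n) K :=
  bitMonomial K α + ∑ β ∈ pathsAbove α, bitMonomial K β

/-- The ideal `⟨y_1 + ⋯ + y_n, y_1², …, y_n²⟩`; the variable `y_{i+1}` is `X i`. -/
def idealI (n : ℕ) : Ideal (MvPolynomial (Fin n) K) :=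
  Ideal.span ({∑ i, X i} ∪ Set.range fun i : Fin n => X i ^ 2)

/-- The set `{y_2², …, y_n²}`. -/
def tailSquares (n : ℕ) : Set (MvPolynomial (Fin n) K) :=
  {f | ∃ i : Fin n, 1 ≤ (i : ℕ) ∧ f = X i ^ 2}

/-- `{y_2², …, y_n²}` together with all `g_α` for `α` a Modified Catalan Path. -/
def fullBasis (n : ℕ) : Set (MvPolynomial (Fin n) K) :=
  tailSquares K n ∪ {f | ∃ α : Fin n → Bool, IsMCP α ∧ f = gPoly K α}

/-- `F_ℓ`: `{y_2², …, y_n²}` together with the `g_α` for the Modified Catalan Paths `α` with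
`ℓ₁(α) - 1 ≤ ℓ`. -/
def stageBasis (n : ℕ) (ℓ : ℤ) : Set (MvPolynomial (Fin n) K) :=
  tailSquares K n ∪ {f | ∃ α : Fin n → Bool, IsMCP α ∧ (ones α : ℤ) - 1 ≤ ℓ ∧ f = gPoly K α}

end Polynomials

end CatalanGroebner

end

/-! Call `α` ballot if every prefix has at most as many ones as zeros. The claim amounts to this:
the monomials outside the leading term ideal are exactly the `y^α` with `α` ballot.

The `g_α` lie in `I`: let `Z` be the `l` zeros of `α` among its first `2l+1` positions. Then `g_α`
is the elementary symmetric polynomial of degree `l+1` in the variables outside `Z`. Modulo `I`,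
`(l+1)! g_α` is the `(l+1)`-st power of their sum, hence up to sign of the sum over `Z`. That power
vanishes, as `Z` has only `l` elements and squares are zero (`IsMCPOfHeight.gPoly_mem`).

No ballot `y^α` is a leading monomial: match the ones of `α` injectively with earlier zeros, and
substitute `-y_j` for the zero matched with `j`. This maps `I` into the ideal of squares but
preserves the coefficient of a leading `y^α` (`exists_lt_two_mul_prefixOnes`). A non-ballot string
is divisible by the MCP cut out at its first violation (`exists_isMCP_dvd`).

Reducedness rests on `IsMCPOfHeight.eq_of_dvd`; uniqueness holds for any ideal and monomial order.
-/

open MvPolynomial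

noncomputable section

namespace CatalanGroebner

/-! ### Uniqueness of reduced Gröbner bases -/

section Uniqueness

variable {σ K : Type*} [Field K] {m : MonomialOrder σ}

/-- The clause `p ≠ 0` is needed: the zero polynomial has degree `0`, below every `e`, but leading
term `0`. -/
theorem monomial_mem_span_leadingTerm_iff {G : Set (MvPolynomial σ K)} {e : σ →₀ ℕ} {c : K}
    (hc : c ≠ 0) :
    monomial e c ∈ Ideal.span (m.leadingTerm '' G) ↔ ∃ p ∈ G, p ≠ 0 ∧ m.degree p ≤ e := by
  classical
  have : (fun p ↦ monomial (m.degree p) (1 : K)) '' (G \ {0}) =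
      (fun s => monomial s (1 : K)) '' (m.degree '' (G \ {0})) := by
    rw [Set.image_image]
  rw [MonomialOrder.span_leadingTerm_eq_span_monomial', this, mem_ideal_span_monomial_image]
  simp [support_monomial, hc, and_assoc]

theorem IsGroebnerBasis.exists_degree_le {I : Ideal (MvPolynomial σ K)}
    {G : Set (MvPolynomial σ K)} (hG : IsGroebnerBasis m I G) {p : MvPolynomial σ K}
    (hp : p ∈ I) (h0 : p ≠ 0) : ∃ q ∈ G, q ≠ 0 ∧ m.degree q ≤ m.degree p := by
  have hlc : m.leadingCoeff p ≠ 0 := m.leadingCoeff_ne_zero_iff.mpr h0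
  rw [← monomial_mem_span_leadingTerm_iff hlc, hG.2.2]
  exact Ideal.subset_span ⟨p, hp, rfl⟩

theorem IsReducedGroebnerBasis.not_degree_le {I : Ideal (MvPolynomial σ K)}
    {G : Set (MvPolynomial σ K)} (hG : IsReducedGroebnerBasis m I G) {p q : MvPolynomial σ K}
    (hp : p ∈ G) (hq : q ∈ G) (hq0 : q ≠ 0) {e : σ →₀ ℕ} (he : e ∈ p.support)
    (hle : m.degree q ≤ e) : q = p := by
  by_contra hne
  exact (hG.2 p hp).2 e he
    ((monomial_mem_span_leadingTerm_iff one_ne_zero).mpr ⟨q, ⟨hq, hne⟩, hq0, hle⟩)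

theorem IsReducedGroebnerBasis.ne_zero {I : Ideal (MvPolynomial σ K)}
    {G : Set (MvPolynomial σ K)} (hG : IsReducedGroebnerBasis m I G) {p : MvPolynomial σ K}
    (hp : p ∈ G) : p ≠ 0 := by
  rintro rfl
  simpa using (hG.2 0 hp).1

/-- Passing from `p` to a divisor in `H` and back to `G` returns to `p`, so `p` and `q` share their
degree. If they differed, the leading monomial of the difference would occur in one of them strictly
below that degree, yet be divisible by a leading monomial of the same basis, against reducedness. -/
theorem IsReducedGroebnerBasis.subset {I : Ideal (MvPolynomial σ K)}
    {G H : Set (MvPolynomial σ K)} (hG : IsReducedGroebnerBasis m I G)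
    (hH : IsReducedGroebnerBasis m I H) : G ⊆ H := by
  classical
  intro p hp
  obtain ⟨q, hq, hq0, hqp⟩ := hH.1.exists_degree_le (hG.1.2.1 hp) (hG.ne_zero hp)
  obtain ⟨r, hr, hr0, hrq⟩ := hG.1.exists_degree_le (hH.1.2.1 hq) hq0
  obtain rfl := hG.not_degree_le hp hr hr0 (m.degree_mem_support (hG.ne_zero hp)) (hrq.trans hqp)
  have hdeg : m.degree r = m.degree q := le_antisymm hrq hqp
  suffices r - q = 0 by rwa [sub_eq_zero.mp this]
  by_contra hne
  have hmem : r - q ∈ I := I.sub_mem (hG.1.2.1 hp) (hH.1.2.1 hq)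
  have hne_deg : m.degree (r - q) ≠ m.degree r := by
    intro h
    have h1 := m.degree_mem_support hne
    rw [h, mem_support_iff, coeff_sub] at h1
    have h2 := (hG.2 r hp).1
    have h3 := (hH.2 q hq).1
    rw [MonomialOrder.leadingCoeff] at h2 h3
    rw [h2, hdeg, h3] at h1
    simp at h1
  have hle : m.toSyn (m.degree (r - q)) ≤ m.toSyn (m.degree r) := by
    have := m.degree_sub_le (f := r) (g := q)
    rwa [hdeg, max_self, ← hdeg] at this
  have hsupp := support_sub σ r q (m.degree_mem_support hne)
  rcases Finset.mem_union.mp hsupp with h | h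
  · obtain ⟨s, hs, hs0, hle'⟩ := hG.1.exists_degree_le hmem hne
    obtain rfl := hG.not_degree_le hp hs hs0 h hle'
    exact hne_deg (m.toSyn.injective (le_antisymm hle (m.toSyn_monotone hle')))
  · obtain ⟨s, hs, hs0, hle'⟩ := hH.1.exists_degree_le hmem hne
    obtain rfl := hH.not_degree_le hq hs hs0 h hle'
    exact hne_deg (m.toSyn.injective (le_antisymm hle (hdeg ▸ m.toSyn_monotone hle')))

/-- An ideal has at most one reduced Gröbner basis. -/
theorem IsReducedGroebnerBasis.unique {I : Ideal (MvPolynomial σ K)}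
    {G H : Set (MvPolynomial σ K)} (hG : IsReducedGroebnerBasis m I G)
    (hH : IsReducedGroebnerBasis m I H) : G = H :=
  (hG.subset hH).antisymm (hH.subset hG)

end Uniqueness

/-! ### Combinatorics of bitstrings and ballot prefixes -/

section Counting

/-- The bit at position `k` of `α` is `1`. -/
def HasBit {n : ℕ} (α : Fin n → Bool) (k : ℕ) : Prop := ∃ h : k < n, α ⟨k, h⟩ = true

instance {n : ℕ} (α : Fin n → Bool) : DecidablePred (HasBit α) := fun _ =>
  inferInstanceAs (Decidable (∃ _, _))

variable {n : ℕ} {α β : Fin n → Bool}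

theorem hasBit_fin {i : Fin n} : HasBit α i ↔ α i = true := by
  simp [HasBit]

/-- The number of entries `1` among the first `k` entries of `α`. -/
def prefixOnes (α : Fin n → Bool) (k : ℕ) : ℕ := Nat.count (HasBit α) k

theorem count_true_take_ofFn (k : ℕ) :
    ((List.ofFn α).take k).count true = prefixOnes α k := by
  induction k with
  | zero => simp [prefixOnes]
  | succ k ih =>
    rw [prefixOnes, Nat.count_succ, ← prefixOnes, ← ih, List.take_add_one, List.count_append]
    congr 1
    by_cases hk : k < n
    · cases h : α ⟨k, hk⟩ <;> simp [HasBit, hk, h]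
    · simp [HasBit, hk]

theorem ones_eq_prefixOnes {d : ℕ} (h : ∀ i : Fin n, d ≤ i → α i = false) :
    ones α = prefixOnes α d := by
  rw [prefixOnes, Nat.count_eq_card_filter_range, ones]
  refine Finset.card_bij (fun i _ => (i : ℕ)) ?_ (fun _ _ _ _ => Fin.ext) ?_
  · intro i hi
    have hi' : α i = true := by simpa using hi
    have : (i : ℕ) < d := by
      by_contra hd
      simp [h i (not_lt.mp hd)] at hi'
    simpa [this, hasBit_fin] using hi'
  · intro k hk
    obtain ⟨-, hkn, hb⟩ : k < d ∧ HasBit α k := by simpa using hk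
    exact ⟨⟨k, hkn⟩, by simpa using hb, rfl⟩

/-- The defining data of a Modified Catalan Path whose last `1` is at index `2 * l`. -/
structure IsMCPOfHeight (α : Fin n → Bool) (l : ℕ) : Prop where
  lt : 2 * l < n
  ballot : ∀ k ≤ 2 * l, 2 * prefixOnes α k ≤ k
  last : prefixOnes α (2 * l + 1) = l + 1
  eq_false : ∀ i : Fin n, 2 * l < i → α i = false

theorem isMCP_iff_exists_height : IsMCP α ↔ ∃ l, IsMCPOfHeight α l := by
  constructor
  · rintro ⟨l, m, w, ⟨hf, ht, hb⟩, hw⟩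
    have hlen : w.length = 2 * l := by
      have := List.count_true_add_count_false w
      omega
    have hn : n = 2 * l + (m + 1) := by
      have := congrArg List.length hw
      simpa [hlen] using this
    refine ⟨l, by omega, fun k hk => ?_, ?_, fun i hi => ?_⟩
    · have h1 := hb k
      have h2 := List.count_true_add_count_false (w.take k)
      rw [← count_true_take_ofFn, hw, List.take_append_of_le_length (by omega)]
      rw [List.length_take] at h2
      omega
    · rw [← count_true_take_ofFn, hw, List.take_append, List.take_of_length_le (by omega), hlen]
      simp [ht]
    · have h1 : (List.ofFn α)[(i : ℕ)]'(by simp) = α i := by simp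
      rw [← h1]
      simp only [hw]
      rw [List.getElem_append_right (by omega)]
      obtain ⟨j, hj⟩ : ∃ j, (i : ℕ) - w.length = j + 1 := ⟨i - w.length - 1, by omega⟩
      simp [hj]
  · rintro ⟨l, hl, hb, ht, hz⟩
    -- At most `l` ones precede index `2 * l`, and `l + 1` are reached just after it, so that bit is
    -- a one.
    have hbit : HasBit α (2 * l) ∧ prefixOnes α (2 * l) = l := by
      have h1 := hb (2 * l) le_rfl
      rw [prefixOnes, Nat.count_succ, ← prefixOnes] at ht
      split_ifs at ht with h
      · exact ⟨h, by omega⟩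
      · omega
    have hcf (k : ℕ) (hk : k ≤ 2 * l) := List.count_true_add_count_false ((List.ofFn α).take k)
    simp only [count_true_take_ofFn, List.length_take, List.length_ofFn] at hcf
    refine ⟨l, n - (2 * l + 1), (List.ofFn α).take (2 * l), ⟨?_, ?_, fun k => ?_⟩, ?_⟩
    · have := hcf (2 * l) le_rfl
      omega
    · rw [count_true_take_ofFn, hbit.2]
    · rw [List.take_take]
      have h1 := hcf (min k (2 * l)) (min_le_right _ _)
      have h2 := hb (min k (2 * l)) (min_le_right _ _)
      rw [count_true_take_ofFn]
      omega
    · refine List.ext_getElem (by simp; omega) fun i h1 h2 => ?_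
      have hin : i < n := by simpa using h1
      rcases lt_trichotomy i (2 * l) with h | h | h
      · rw [List.getElem_append_left (by simp; omega)]
        simp
      · subst h
        rw [List.getElem_append_right (by simp)]
        obtain ⟨_, hb⟩ := hbit.1
        simp [hb, hl.le]
      · rw [List.getElem_append_right (by simp; omega)]
        obtain ⟨j, hj⟩ : ∃ j, i = 2 * l + (j + 1) := ⟨i - 2 * l - 1, by omega⟩
        subst hj
        simp [hl.le, hz ⟨2 * l + (j + 1), hin⟩ (by simp)]

theorem IsMCPOfHeight.ones_eq {l : ℕ} (h : IsMCPOfHeight α l) : ones α = l + 1 := by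
  rw [ones_eq_prefixOnes (d := 2 * l + 1) (fun i hi => h.eq_false i hi), h.last]

theorem prefixOnes_mono {k : ℕ} (h : ∀ i : Fin n, (i : ℕ) < k → α i = true → β i = true) :
    prefixOnes α k ≤ prefixOnes β k :=
  Nat.count_mono_left fun j hj ⟨hjn, hb⟩ => ⟨hjn, h ⟨j, hjn⟩ hj hb⟩

theorem ones_mono (h : ∀ i : Fin n, α i = true → β i = true) : ones α ≤ ones β :=
  Finset.card_le_card fun i hi => by simpa using h i (by simpa using hi)

theorem eq_of_imp_of_ones_le (h : ∀ i : Fin n, α i = true → β i = true) (hle : ones β ≤ ones α) :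
    α = β := by
  have hsub : (Finset.univ.filter fun i => α i = true) ⊆ Finset.univ.filter fun i => β i = true :=
    fun i hi => by simpa using h i (by simpa using hi)
  have heq := Finset.eq_of_subset_of_card_le hsub hle
  funext i
  have : α i = true ↔ β i = true := by simpa using Finset.ext_iff.mp heq i
  cases ha : α i <;> cases hb : β i <;> simp_all

/-- The only Modified Catalan Path dividing a monomial of `g_α` is `α`. -/
theorem IsMCPOfHeight.eq_of_dvd {α' : Fin n → Bool} {l l' : ℕ} (h : IsMCPOfHeight α l)
    (h' : IsMCPOfHeight α' l') (hβ : ones β = ones α)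
    (hβα : ∀ i : Fin n, (i : ℕ) < 2 * l + 1 → α i = false → β i = false)
    (hdvd : ∀ i : Fin n, α' i = true → β i = true) : α' = α := by
  have hones := ones_mono hdvd
  rw [hβ, h.ones_eq, h'.ones_eq] at hones
  have himp : ∀ i : Fin n, α' i = true → α i = true := by
    intro i hi
    have hil : (i : ℕ) < 2 * l + 1 := by
      by_contra hlt
      simp [h'.eq_false i (by omega)] at hi
    by_contra hα
    simpa [hβα i hil (by simpa using hα)] using hdvd i hi
  -- Otherwise the prefix of `α` of length `2 * l' + 1 ≤ 2 * l` would contain `l' + 1` ones.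
  have hll : l ≤ l' := by
    by_contra hlt
    have h1 := h.ballot (2 * l' + 1) (by omega)
    have h2 := prefixOnes_mono (k := 2 * l' + 1) (fun i _ => himp i)
    rw [h'.last] at h2
    omega
  refine eq_of_imp_of_ones_le himp ?_
  rw [h.ones_eq, h'.ones_eq]
  omega

/-- A bitstring violating the ballot condition is divisible by a Modified Catalan Path. -/
theorem exists_isMCP_dvd {k : ℕ} (hk : k < 2 * prefixOnes α k) :
    ∃ β : Fin n → Bool, IsMCP β ∧ ∀ i, β i = true → α i = true := by
  classical
  have hex : ∃ k, k < 2 * prefixOnes α k := ⟨k, hk⟩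
  obtain ⟨d, hd⟩ : ∃ d, d = Nat.find hex := ⟨_, rfl⟩
  have hspec : d < 2 * prefixOnes α d := hd ▸ Nat.find_spec hex
  have hmin : ∀ j < d, 2 * prefixOnes α j ≤ j := fun j hj =>
    not_lt.mp (Nat.find_min hex (hd ▸ hj))
  obtain ⟨j, rfl⟩ : ∃ j, d = j + 1 := by
    refine Nat.exists_eq_succ_of_ne_zero ?_
    rintro rfl
    simp [prefixOnes] at hspec
  have hj := hmin j (by omega)
  have hstep : prefixOnes α (j + 1) = prefixOnes α j + if HasBit α j then 1 else 0 :=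
    Nat.count_succ _ _
  have hbit : HasBit α j := by
    by_contra hb
    rw [if_neg hb] at hstep
    omega
  rw [if_pos hbit] at hstep
  -- With `p` ones before `j`, minimality gives `2p ≤ j` and the violation gives `j + 1 < 2(p + 1)`.
  obtain ⟨l, hl⟩ : ∃ l, j = 2 * l := ⟨prefixOnes α j, by omega⟩
  subst hl
  let β : Fin n → Bool := fun i => α i && decide ((i : ℕ) < 2 * l + 1)
  have hβ : ∀ i : Fin n, β i = true ↔ α i = true ∧ (i : ℕ) < 2 * l + 1 := fun i => by simp [β]
  have hpre : ∀ k ≤ 2 * l + 1, prefixOnes β k = prefixOnes α k := fun k hk =>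
    le_antisymm (prefixOnes_mono fun i _ hi => ((hβ i).mp hi).1)
      (prefixOnes_mono fun i hik hi => (hβ i).mpr ⟨hi, by omega⟩)
  refine ⟨β, isMCP_iff_exists_height.mpr ⟨l, ⟨hbit.1, fun k hk => ?_, ?_, fun i hi => ?_⟩⟩,
    fun i hi => ((hβ i).mp hi).1⟩
  · rw [hpre k (by omega)]
    exact hmin k (by omega)
  · rw [hpre _ le_rfl]
    omega
  · simp [β]
    omega

/-- If every prefix of `α` has at most as many ones as zeros, the ones can be matched with
earlier zeros. -/
theorem exists_matching (h : ∀ k, 2 * prefixOnes α k ≤ k) :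
    ∃ μ : Fin n → Fin n, (∀ i, α i = true → α (μ i) = false ∧ μ i < i) ∧
      ∀ i j, α i = true → α j = true → μ i = μ j → i = j := by
  classical
  let q : ℕ → Prop := fun k => ¬ HasBit α k
  have hcount : ∀ k, prefixOnes α k + Nat.count q k = k := by
    intro k
    induction k with
    | zero => simp [prefixOnes]
    | succ k ih =>
      have := Nat.count_succ (HasBit α) k
      have := Nat.count_succ q k
      simp only [prefixOnes, q] at *
      split_ifs at * <;> omega
  -- Positions from `n` on count as zeros, so `Nat.nth q` never takes its default value.
  have hqinf : (Set.ofPred q).Infinite :=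
    Set.infinite_of_injective_forall_mem (f := fun k => n + k) (fun a b hab => by simpa using hab)
      (fun k => show ¬ HasBit α (n + k) from fun ⟨hlt, _⟩ => by omega)
  -- The one preceded by `c` ones goes to the zero preceded by `c` zeros. The ballot condition at `i
  -- + 1` puts more than `c` zeros before `i`.
  let ν : ℕ → ℕ := fun k => Nat.nth q (Nat.count (HasBit α) k)
  have hν : ∀ i, HasBit α i → ν i < i := by
    intro i hi
    refine Nat.nth_lt_of_lt_count ?_
    have h1 := h (i + 1)
    have h2 := hcount i
    rw [prefixOnes, Nat.count_succ, if_pos hi] at h1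
    rw [prefixOnes] at h2
    omega
  refine ⟨fun i => if hi : α i = true then ⟨ν i, (hν i (hasBit_fin.mpr hi)).trans i.2⟩ else i,
    fun i hi => ?_, fun i j hi hj hij => ?_⟩
  · simp only [hi, dite_true]
    have hq : q (ν i) := Nat.nth_mem_of_infinite hqinf _
    refine ⟨?_, hν i (hasBit_fin.mpr hi)⟩
    by_contra hb
    exact hq ⟨(hν i (hasBit_fin.mpr hi)).trans i.2, by simpa using hb⟩
  · simp only [hi, hj, dite_true, Fin.mk.injEq, ν] at hij
    exact Fin.ext (Nat.count_injective (hasBit_fin.mpr hi) (hasBit_fin.mpr hj)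
      (Nat.nth_injective hqinf hij))

end Counting

/-! ### Powers of sums of square-zero elements -/

section SquareZero

variable {R ι : Type*} [CommRing R]

theorem add_pow_succ_of_sq_eq_zero {a : R} (ha : a ^ 2 = 0) (b : R) (k : ℕ) :
    (a + b) ^ (k + 1) = b ^ (k + 1) + (k + 1) * (a * b ^ k) := by
  induction k with
  | zero => ring
  | succ k ih =>
    rw [pow_succ, ih]
    push_cast
    linear_combination (k + 1) * b ^ k * ha

/-- The powers of a sum of elements with square zero are multiples of elementary symmetric
polynomials. -/
theorem sum_pow_eq_factorial_mul_of_sq_eq_zero [DecidableEq ι] {a : ι → R} (h : ∀ i, a i ^ 2 = 0)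
    (s : Finset ι) (k : ℕ) :
    (∑ i ∈ s, a i) ^ k = k.factorial * ∑ t ∈ s.powersetCard k, ∏ i ∈ t, a i := by
  induction s using Finset.induction_on generalizing k with
  | empty =>
    cases k with
    | zero => simp
    | succ k => rw [Finset.powersetCard_eq_empty.mpr (by simp)]; simp
  | insert x s hx ih =>
    cases k with
    | zero => simp
    | succ k =>
      rw [Finset.sum_insert hx, add_pow_succ_of_sq_eq_zero (h x), ih, ih,
        Finset.powersetCard_succ_insert hx, Finset.sum_union, Finset.sum_image]
      · have : ∑ t ∈ s.powersetCard k, ∏ i ∈ insert x t, a i =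
            a x * ∑ t ∈ s.powersetCard k, ∏ i ∈ t, a i := by
          rw [Finset.mul_sum]
          refine Finset.sum_congr rfl fun t ht => ?_
          rw [Finset.prod_insert fun hxt => hx ((Finset.mem_powersetCard.mp ht).1 hxt)]
        rw [this, Nat.factorial_succ]
        push_cast
        ring
      · intro t ht u hu htu
        have hxt : x ∉ t := fun hxt => hx ((Finset.mem_powersetCard.mp ht).1 hxt)
        have hxu : x ∉ u := fun hxu => hx ((Finset.mem_powersetCard.mp hu).1 hxu)
        rw [← Finset.erase_insert hxt, htu, Finset.erase_insert hxu]
      · rw [Finset.disjoint_left]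
        intro t ht ht'
        obtain ⟨u, -, rfl⟩ := Finset.mem_image.mp ht'
        exact hx ((Finset.mem_powersetCard.mp ht).1 (Finset.mem_insert_self x u))

/-- The sum over `Zᶜ` is minus the sum over `Z`, whose `k`-th power vanishes because `Z` has no
`k`-element subset. -/
theorem factorial_mul_esymm_compl_eq_zero [Fintype ι] [DecidableEq ι] {a : ι → R}
    (h : ∀ i, a i ^ 2 = 0) (hsum : ∑ i, a i = 0) {Z : Finset ι} {k : ℕ} (hZ : Z.card < k) :
    (k.factorial : R) * ∑ t ∈ Zᶜ.powersetCard k, ∏ i ∈ t, a i = 0 := by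
  have hcompl : ∑ i ∈ Zᶜ, a i = -∑ i ∈ Z, a i := by
    rw [eq_neg_iff_add_eq_zero, Finset.sum_compl_add_sum, hsum]
  rw [← sum_pow_eq_factorial_mul_of_sq_eq_zero h, hcompl, neg_pow,
    sum_pow_eq_factorial_mul_of_sq_eq_zero h, Finset.powersetCard_eq_empty.mpr hZ]
  simp

end SquareZero

/-! ### Exponent vectors and the lexicographic order -/

section Exponents

variable {n : ℕ} {α β : Fin n → Bool}

/-- The exponent vector of the monomial `y^α`. -/
def expo (α : Fin n → Bool) : Fin n →₀ ℕ := Finsupp.equivFunOnFinite.symm fun i => (α i).toNat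

@[simp]
theorem expo_apply (i : Fin n) : expo α i = (α i).toNat := rfl

theorem expo_injective : Function.Injective (expo (n := n)) := by
  intro α β h
  funext i
  have : (α i).toNat = (β i).toNat := DFunLike.congr_fun h i
  cases ha : α i <;> cases hb : β i <;> simp_all

theorem expo_le_expo_iff : expo α ≤ expo β ↔ ∀ i, α i = true → β i = true := by
  rw [Finsupp.le_def]
  refine forall_congr' fun i => ?_
  cases ha : α i <;> cases hb : β i <;> simp [ha, hb]

theorem bitMonomial_eq (K : Type*) [Field K] (α : Fin n → Bool) :
    bitMonomial K α = monomial (expo α) 1 := by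
  rw [monomial_eq, Finsupp.prod_fintype _ _ (by simp)]
  simp [bitMonomial]

theorem exists_first_ne {γ : Type*} {a b : Fin n → γ} (h : a ≠ b) :
    ∃ i, (∀ j < i, a j = b j) ∧ a i ≠ b i := by
  obtain ⟨i, hi, hmin⟩ := WellFounded.has_min (wellFounded_lt (α := Fin n))
    (Set.ofPred fun i => a i ≠ b i) (Function.ne_iff.mp h)
  exact ⟨i, fun j hj => not_not.mp fun hne => hmin j hne hj, hi⟩

theorem lex_lt_of_first_lt {a b : Fin n →₀ ℕ} {i : Fin n} (h : ∀ j < i, a j = b j)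
    (hi : a i < b i) : MonomialOrder.lex.toSyn a < MonomialOrder.lex.toSyn b :=
  MonomialOrder.lex_lt_iff.mpr (Finsupp.Lex.lt_iff.mpr ⟨i, h, hi⟩)

end Exponents

/-! ### The polynomials `g_α`: leading terms and membership in the ideal -/

section Generators

variable {K : Type*} [Field K] {n : ℕ} {α β : Fin n → Bool} {l : ℕ}

theorem self_notMem_pathsAbove : α ∉ pathsAbove α := by simp [pathsAbove]

theorem gPoly_eq_sum : gPoly K α = ∑ β ∈ insert α (pathsAbove α), monomial (expo β) (1 : K) := by
  rw [Finset.sum_insert self_notMem_pathsAbove]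
  simp [gPoly, bitMonomial_eq]

theorem IsMCPOfHeight.mem_insert_pathsAbove (h : IsMCPOfHeight α l) :
    β ∈ insert α (pathsAbove α) ↔ ones β = ones α ∧
      ∀ i : Fin n, (i : ℕ) < 2 * l + 1 → α i = false → β i = false := by
  have hd : 2 * ones α - 1 = 2 * l + 1 := by rw [h.ones_eq]; omega
  by_cases hβ : β = α
  · subst hβ
    simp
  · simp only [Finset.mem_insert, hβ, false_or, pathsAbove, hd, Finset.mem_filter, Finset.mem_univ,
      true_and, ne_eq, not_false_eq_true, Nat.succ_le_iff]

theorem coeff_gPoly_self : coeff (expo α) (gPoly K α) = 1 := by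
  classical
  rw [gPoly_eq_sum, coeff_sum, Finset.sum_eq_single_of_mem α (Finset.mem_insert_self _ _)]
  · rw [coeff_monomial, if_pos rfl]
  · intro β _ hne
    rw [coeff_monomial]
    exact if_neg fun he => hne (expo_injective he)

theorem exists_of_mem_support_gPoly {e : Fin n →₀ ℕ} (he : e ∈ (gPoly K α).support) :
    ∃ β ∈ insert α (pathsAbove α), e = expo β := by
  classical
  rw [gPoly_eq_sum] at he
  obtain ⟨β, hβ, hmem⟩ := Finset.mem_biUnion.mp (support_sum he)
  exact ⟨β, hβ, by simpa using support_monomial_subset hmem⟩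

/-- If `β` had a one and `α` a zero at the first difference, that position would lie beyond the last
one of `α`. Then `β` would contain all ones of `α`, and equal counts would force `β = α`. -/
theorem IsMCPOfHeight.expo_le_of_mem (h : IsMCPOfHeight α l) (hβ : β ∈ insert α (pathsAbove α)) :
    MonomialOrder.lex.toSyn (expo β) ≤ MonomialOrder.lex.toSyn (expo α) := by
  by_cases hne : β = α
  · rw [hne]
  obtain ⟨hones, hpath⟩ := h.mem_insert_pathsAbove.mp hβ
  obtain ⟨i, hj, hi⟩ := exists_first_ne hne
  refine (lex_lt_of_first_lt (i := i) (fun j hji => by simp [hj j hji]) ?_).le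
  by_cases hα : α i = true
  · have : β i = false := by simpa [hα] using hi
    simp [hα, this]
  · exfalso
    have hα' : α i = false := by simpa using hα
    have hil : 2 * l < i := by
      by_contra hlt
      exact hi (by rw [hα', hpath i (by omega) hα'])
    refine hne (eq_of_imp_of_ones_le (fun k hk => ?_) hones.le).symm
    have : (k : ℕ) ≤ 2 * l := by
      by_contra hlt
      simp [h.eq_false k (by omega)] at hk
    rw [hj k (Fin.lt_def.mpr (by omega)), hk]

theorem IsMCPOfHeight.degree_gPoly (h : IsMCPOfHeight α l) :
    MonomialOrder.lex.degree (gPoly K α) = expo α := by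
  refine MonomialOrder.lex.toSyn.injective (le_antisymm ?_ ?_)
  · refine MonomialOrder.degree_le_iff.mpr fun e he => ?_
    obtain ⟨β, hβ, rfl⟩ := exists_of_mem_support_gPoly he
    exact h.expo_le_of_mem hβ
  · exact MonomialOrder.le_degree (by simp [mem_support_iff, coeff_gPoly_self])

theorem IsMCPOfHeight.leadingCoeff_gPoly (h : IsMCPOfHeight α l) :
    MonomialOrder.lex.leadingCoeff (gPoly K α) = 1 := by
  rw [MonomialOrder.leadingCoeff, h.degree_gPoly, coeff_gPoly_self]

theorem gPoly_ne_zero : gPoly K α ≠ 0 := by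
  intro h
  simpa [h] using coeff_gPoly_self (K := K) (α := α)

theorem IsMCPOfHeight.card_zeros (h : IsMCPOfHeight α l) :
    (Finset.univ.filter fun i : Fin n => (i : ℕ) < 2 * l + 1 ∧ α i = false).card = l := by
  have h1 : (Finset.univ.filter fun i : Fin n => (i : ℕ) < 2 * l + 1 ∧ α i = true).card = l + 1 := by
    rw [← h.ones_eq, ones]
    congr 1
    ext i
    simp only [Finset.mem_filter, Finset.mem_univ, true_and, and_iff_right_iff_imp]
    intro hi
    by_contra hlt
    simp [h.eq_false i (by omega)] at hi
  have h2 := Finset.card_filter_add_card_filter_not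
    (s := Finset.univ.filter fun i : Fin n => (i : ℕ) < 2 * l + 1) (fun i => α i = true)
  have h3 : (Finset.univ.filter fun i : Fin n => (i : ℕ) < 2 * l + 1).card = 2 * l + 1 := by
    have := h.lt
    rw [Fin.card_filter_val_lt]
    omega
  simp only [Finset.filter_filter, Bool.not_eq_true, h1, h3] at h2
  omega

/-- Identify `β` with its set of ones: the condition defining `pathsAbove` says that this set avoids
the early zeros of `α`. -/
theorem IsMCPOfHeight.gPoly_eq_esymm (h : IsMCPOfHeight α l) :
    gPoly K α = ∑ t ∈ (Finset.univ.filter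
      fun i : Fin n => (i : ℕ) < 2 * l + 1 ∧ α i = false)ᶜ.powersetCard (l + 1),
      ∏ i ∈ t, X i := by
  have : gPoly K α = ∑ β ∈ insert α (pathsAbove α), bitMonomial K β := by
    simp [gPoly_eq_sum, bitMonomial_eq]
  rw [this]
  refine Finset.sum_bij' (fun β _ => Finset.univ.filter fun i => β i = true)
    (fun t _ i => decide (i ∈ t)) ?_ ?_ ?_ ?_ ?_
  · intro β hβ
    obtain ⟨hones, hpath⟩ := h.mem_insert_pathsAbove.mp hβ
    refine Finset.mem_powersetCard.mpr ⟨fun i hi => ?_, by rw [← h.ones_eq, ← hones, ones]⟩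
    simp only [Finset.mem_compl, Finset.mem_filter, Finset.mem_univ, true_and] at hi ⊢
    rintro ⟨h1, h2⟩
    simp [hpath i h1 h2] at hi
  · intro t ht
    obtain ⟨hsub, hcard⟩ := Finset.mem_powersetCard.mp ht
    refine h.mem_insert_pathsAbove.mpr ⟨by rw [h.ones_eq]; simp [ones, hcard], fun i h1 h2 => ?_⟩
    simp only [decide_eq_false_iff_not]
    intro hi
    exact Finset.mem_compl.mp (hsub hi) (Finset.mem_filter.mpr ⟨Finset.mem_univ i, h1, h2⟩)
  · intro β _
    funext i
    simp
  · intro t _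
    ext i
    simp
  · intro β _
    rw [bitMonomial, Finset.prod_filter]
    refine Finset.prod_congr rfl fun i _ => ?_
    cases β i <;> simp

theorem X_sq_mem_idealI (i : Fin n) : (X i ^ 2 : MvPolynomial (Fin n) K) ∈ idealI K n :=
  Ideal.subset_span (Or.inr ⟨i, rfl⟩)

theorem IsMCPOfHeight.gPoly_mem [CharZero K] (h : IsMCPOfHeight α l) :
    gPoly K α ∈ idealI K n := by
  let φ := Ideal.Quotient.mk (idealI K n)
  let a : Fin n → MvPolynomial (Fin n) K ⧸ idealI K n := fun i => φ (X i)
  have ha : ∀ i, a i ^ 2 = 0 := fun i => by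
    rw [← map_pow]
    exact Ideal.Quotient.eq_zero_iff_mem.mpr (X_sq_mem_idealI i)
  have hsum : ∑ i, a i = 0 := by
    rw [← map_sum]
    exact Ideal.Quotient.eq_zero_iff_mem.mpr (Ideal.subset_span (Or.inl rfl))
  have hg : ((l + 1).factorial : MvPolynomial (Fin n) K ⧸ idealI K n) * φ (gPoly K α) = 0 := by
    rw [h.gPoly_eq_esymm, map_sum]
    simp only [map_prod]
    exact factorial_mul_esymm_compl_eq_zero ha hsum (by rw [h.card_zeros]; omega)
  rw [← map_natCast φ, ← map_mul] at hg
  have hmem := Ideal.Quotient.eq_zero_iff_mem.mp hg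
  -- Characteristic zero allows division by `(l + 1)!`.
  have hunit : C ((l + 1).factorial : K)⁻¹ * (((l + 1).factorial : MvPolynomial (Fin n) K) *
      gPoly K α) = gPoly K α := by
    rw [← mul_assoc, ← map_natCast C, ← map_mul, inv_mul_cancel₀, map_one, one_mul]
    exact_mod_cast (l + 1).factorial_ne_zero
  rw [← hunit]
  exact Ideal.mul_mem_left _ _ hmem

end Generators

/-! ### Ballot monomials are not leading monomials -/

section LeadingTerms

variable {K : Type*} [Field K] {n : ℕ} {α : Fin n → Bool}

/-- The coefficient attached to the variable `y_i`: ones have coefficient `1`, the zeros matched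
by `μ` have coefficient `-1`, the other zeros have coefficient `0`. -/
def matchCoeff (K : Type*) [Field K] (α : Fin n → Bool) (μ : Fin n → Fin n) (i : Fin n) : K :=
  open Classical in if α i = true then 1 else if ∃ j, α j = true ∧ μ j = i then -1 else 0

/-- The one matched with a zero; all other positions are fixed. -/
def matchPartner (α : Fin n → Bool) (μ : Fin n → Fin n) (i : Fin n) : Fin n :=
  open Classical in
  if h : α i = false ∧ ∃ j, α j = true ∧ μ j = i then h.2.choose else i

theorem matchPartner_of_true (μ : Fin n → Fin n) {i : Fin n} (hi : α i = true) :
    matchPartner α μ i = i := by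
  simp [matchPartner, hi]

theorem matchPartner_matched {μ : Fin n → Fin n} (hμ : ∀ i, α i = true → α (μ i) = false ∧ μ i < i)
    (hinj : ∀ i j, α i = true → α j = true → μ i = μ j → i = j) {j : Fin n} (hj : α j = true) :
    matchPartner α μ (μ j) = j := by
  have hex : α (μ j) = false ∧ ∃ k, α k = true ∧ μ k = μ j := ⟨(hμ j hj).1, j, hj, rfl⟩
  rw [matchPartner, dif_pos hex]
  exact hinj _ _ hex.2.choose_spec.1 hj hex.2.choose_spec.2

/-- Send each one to its own variable, each matched zero to minus the variable of its partner, and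
the other zeros to `0`. -/
def matchHom (K : Type*) [Field K] (α : Fin n → Bool) (μ : Fin n → Fin n) :
    MvPolynomial (Fin n) K →ₐ[K] MvPolynomial (Fin n) K :=
  aeval fun i => C (matchCoeff K α μ i) * X (matchPartner α μ i)

variable {μ : Fin n → Fin n}

theorem matchHom_sum_X (hμ : ∀ i, α i = true → α (μ i) = false ∧ μ i < i)
    (hinj : ∀ i j, α i = true → α j = true → μ i = μ j → i = j) :
    matchHom K α μ (∑ i, X i) = 0 := by
  classical
  -- Written this way, the total is a difference of two sums over the ones of `α`, equal after
  -- exchanging the order of summation.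
  have hterm : ∀ i, C (matchCoeff K α μ i) * X (matchPartner α μ i) =
      (if α i = true then X i else 0) -
        ∑ j, if α j = true then (if μ j = i then (X j : MvPolynomial (Fin n) K) else 0) else 0 := by
    intro i
    by_cases hi : α i = true
    · rw [matchPartner_of_true μ hi, if_pos hi, Finset.sum_eq_zero, matchCoeff, if_pos hi]
      · simp
      · intro j _
        split_ifs with h1 h2
        · have := (hμ j h1).1
          simp [h2, hi] at this
        · rfl
        · rfl
    · by_cases hex : ∃ j, α j = true ∧ μ j = i
      · obtain ⟨j, hj, rfl⟩ := hex
        rw [matchPartner_matched hμ hinj hj, if_neg hi, Finset.sum_eq_single j, matchCoeff,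
          if_neg hi, if_pos ⟨j, hj, rfl⟩]
        · simp [hj]
        · intro k _ hkj
          split_ifs with h1 h2
          · exact absurd (hinj k j h1 hj h2) hkj
          · rfl
          · rfl
        · simp
      · rw [if_neg hi, Finset.sum_eq_zero, matchCoeff, if_neg hi, if_neg hex]
        · simp
        · intro j _
          split_ifs with h1 h2
          · exact absurd ⟨j, h1, h2⟩ hex
          · rfl
          · rfl
  simp only [matchHom, map_sum, aeval_X, hterm, Finset.sum_sub_distrib]
  rw [Finset.sum_comm (γ := Fin n), sub_eq_zero]
  refine Finset.sum_congr rfl fun j _ => ?_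
  split_ifs <;> simp

theorem matchHom_mem_span_sq (hμ : ∀ i, α i = true → α (μ i) = false ∧ μ i < i)
    (hinj : ∀ i j, α i = true → α j = true → μ i = μ j → i = j)
    {p : MvPolynomial (Fin n) K} (hp : p ∈ idealI K n) :
    matchHom K α μ p ∈
      Ideal.span (Set.range fun i : Fin n => (X i ^ 2 : MvPolynomial (Fin n) K)) := by
  suffices idealI K n ≤ Ideal.comap (matchHom K α μ)
      (Ideal.span (Set.range fun i : Fin n => (X i ^ 2 : MvPolynomial (Fin n) K))) from this hp
  rw [idealI, Ideal.span_le]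
  rintro q (rfl | ⟨i, rfl⟩)
  · rw [SetLike.mem_coe, Ideal.mem_comap, matchHom_sum_X hμ hinj]
    exact zero_mem _
  · rw [SetLike.mem_coe, Ideal.mem_comap, map_pow, matchHom, aeval_X, mul_pow]
    exact Ideal.mul_mem_left _ _ (Ideal.subset_span ⟨_, rfl⟩)

theorem coeff_expo_eq_zero_of_mem_span_sq {p : MvPolynomial (Fin n) K}
    (hp : p ∈ Ideal.span (Set.range fun i : Fin n => (X i ^ 2 : MvPolynomial (Fin n) K))) :
    coeff (expo α) p = 0 := by
  have hrange : (Set.range fun i : Fin n => (X i ^ 2 : MvPolynomial (Fin n) K)) =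
      (fun s => monomial s (1 : K)) '' Set.range fun i : Fin n => Finsupp.single i 2 := by
    rw [← Set.range_comp]
    simp [Function.comp_def, X_pow_eq_monomial]
  rw [hrange, mem_ideal_span_monomial_image] at hp
  by_contra hne
  obtain ⟨_, ⟨i, rfl⟩, hle⟩ := hp (expo α) (mem_support_iff.mpr hne)
  have h1 := hle i
  have h2 := (α i).toNat_le
  simp at h1
  omega

theorem matchHom_monomial (e : Fin n →₀ ℕ) (c : K) :
    matchHom K α μ (monomial e c) =
      monomial (∑ i, Finsupp.single (matchPartner α μ i) (e i))
        (c * ∏ i, matchCoeff K α μ i ^ e i) := by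
  rw [matchHom, aeval_monomial, Finsupp.prod_fintype _ _ (by simp)]
  simp only [mul_pow, Finset.prod_mul_distrib, X_pow_eq_monomial, ← monomial_sum_one, ← map_pow,
    ← map_prod, algebraMap_eq]
  rw [← mul_assoc, ← map_mul, C_mul_monomial, mul_one]

/-- At the first difference `i`, `α` has a one and `e` is zero. So `y_i` could only come from the
variable at `μ i < i`, where `e` still agrees with `α` and hence vanishes. -/
theorem coeff_matchHom_monomial_eq_zero
    (hμ : ∀ i, α i = true → α (μ i) = false ∧ μ i < i)
    (hinj : ∀ i j, α i = true → α j = true → μ i = μ j → i = j)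
    {e : Fin n →₀ ℕ}
    (he : MonomialOrder.lex.toSyn e < MonomialOrder.lex.toSyn (expo α)) (c : K) :
    coeff (expo α) (matchHom K α μ (monomial e c)) = 0 := by
  classical
  rw [matchHom_monomial, coeff_monomial]
  split_ifs with hw
  swap
  · rfl
  by_contra hne
  have hc : ∀ i, e i ≠ 0 → matchCoeff K α μ i ≠ 0 := fun i hi h0 =>
    hne (by rw [Finset.prod_eq_zero (Finset.mem_univ i) (by rw [h0, zero_pow hi]), mul_zero])
  have hw' : ∀ k, ∑ i, (Finsupp.single (matchPartner α μ i) (e i)) k = (α k).toNat := fun k => by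
    rw [← expo_apply, ← hw, Finsupp.finsetSum_apply]
  obtain ⟨i, hj, hi⟩ := MonomialOrder.lex_lt_iff.mp he
  replace hj : ∀ j < i, e j = (α j).toNat := hj
  replace hi : e i < (α i).toNat := hi
  have hαi : α i = true := by
    by_contra h
    rw [Bool.eq_false_of_not_eq_true h] at hi
    exact Nat.not_lt_zero _ hi
  have hei : e i = 0 := by simpa [hαi] using hi
  obtain ⟨k, -, hk⟩ := Finset.exists_ne_zero_of_sum_ne_zero
    (s := Finset.univ) (f := fun k => (Finsupp.single (matchPartner α μ k) (e k)) i)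
    (by rw [hw' i, hαi]; simp)
  obtain ⟨hki, hek⟩ : matchPartner α μ k = i ∧ e k ≠ 0 := by
    rw [Finsupp.single_apply] at hk
    split_ifs at hk with h
    · exact ⟨h, hk⟩
    · exact absurd rfl hk
  have hck := hc k hek
  rw [matchCoeff] at hck
  split_ifs at hck with h1 h2
  · rw [matchPartner_of_true μ h1] at hki
    exact hek (hki ▸ hei)
  · obtain ⟨j, hjα, rfl⟩ := h2
    rw [matchPartner_matched hμ hinj hjα] at hki
    subst hki
    rw [hj _ (hμ j hjα).2, (hμ j hjα).1] at hek
    exact hek rfl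
  · exact hck rfl

theorem coeff_matchHom_monomial_expo (c : K) :
    coeff (expo α) (matchHom K α μ (monomial (expo α) c)) = c := by
  classical
  have h1 : ∑ i, Finsupp.single (matchPartner α μ i) (expo α i) = expo α := by
    conv_rhs => rw [← Finsupp.univ_sum_single (expo α)]
    refine Finset.sum_congr rfl fun i _ => ?_
    cases hi : α i
    · simp [hi]
    · rw [matchPartner_of_true μ hi]
  have h2 : ∏ i, matchCoeff K α μ i ^ expo α i = 1 := by
    refine Finset.prod_eq_one fun i _ => ?_
    cases hi : α i <;> simp [hi, matchCoeff]
  rw [matchHom_monomial, h1, h2, coeff_monomial, if_pos rfl, mul_one]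

/-- The leading exponent of an element of the ideal is not a square-free ballot sequence. -/
theorem exists_lt_two_mul_prefixOnes {p : MvPolynomial (Fin n) K} (hp : p ∈ idealI K n)
    (h0 : p ≠ 0) (hdeg : MonomialOrder.lex.degree p = expo α) : ∃ k, k < 2 * prefixOnes α k := by
  by_contra! hball
  obtain ⟨μ, hμ, hinj⟩ := exists_matching hball
  have hzero := coeff_expo_eq_zero_of_mem_span_sq (α := α) (matchHom_mem_span_sq hμ hinj hp)
  have hmem := hdeg ▸ MonomialOrder.lex.degree_mem_support h0
  -- Only the leading monomial contributes to this coefficient, so it equals the nonzero leading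
  -- coefficient of `p`.
  rw [p.as_sum, map_sum, coeff_sum, Finset.sum_eq_single_of_mem _ hmem,
    coeff_matchHom_monomial_expo] at hzero
  · exact mem_support_iff.mp hmem hzero
  · intro e he hne
    refine coeff_matchHom_monomial_eq_zero hμ hinj (lt_of_le_of_ne ?_ ?_) _
    · rw [← hdeg]
      exact MonomialOrder.le_degree he
    · exact fun h => hne (MonomialOrder.lex.toSyn.injective h)

end LeadingTerms

/-! ### Assembling the reduced Gröbner basis -/

section Basis

variable (K : Type*) [Field K] (n : ℕ)

variable {K n} in
theorem degree_X_sq (i : Fin n) :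
    MonomialOrder.lex.degree (X i ^ 2 : MvPolynomial (Fin n) K) = Finsupp.single i 2 := by
  classical
  simp [X_pow_eq_monomial, MonomialOrder.degree_monomial]

variable {K n} in
theorem exists_mem_fullBasis_degree_le {p : MvPolynomial (Fin n) K} (hp : p ∈ idealI K n)
    (h0 : p ≠ 0) : ∃ q ∈ fullBasis K n, q ≠ 0 ∧
      MonomialOrder.lex.degree q ≤ MonomialOrder.lex.degree p := by
  obtain ⟨e, he⟩ : ∃ e, e = MonomialOrder.lex.degree p := ⟨_, rfl⟩
  rw [← he]
  -- `y^α` is the square-free part of the leading monomial. If `α` is ballot, `e` cannot equal `expo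
  -- α`, so some exponent is at least `2`.
  let α : Fin n → Bool := fun i => decide (e i ≠ 0)
  have hα : expo α ≤ e := fun i => by
    by_cases hi : e i = 0
    · simp [α, hi]
    · simpa [α, hi] using Nat.one_le_iff_ne_zero.mpr hi
  by_cases hball : ∃ k, k < 2 * prefixOnes α k
  · obtain ⟨k, hk⟩ := hball
    obtain ⟨β, hβ, hdvd⟩ := exists_isMCP_dvd hk
    obtain ⟨l, hl⟩ := isMCP_iff_exists_height.mp hβ
    exact ⟨gPoly K β, Or.inr ⟨β, hβ, rfl⟩, gPoly_ne_zero,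
      hl.degree_gPoly.trans_le ((expo_le_expo_iff.mpr hdvd).trans hα)⟩
  · have hne : e ≠ expo α := fun h =>
      hball (exists_lt_two_mul_prefixOnes hp h0 (he.symm.trans h))
    obtain ⟨i, hi⟩ := DFunLike.ne_iff.mp hne
    have hi2 : 2 ≤ e i := by
      by_contra hlt
      interval_cases hei : e i <;> simp [α, hei] at hi
    refine ⟨X i ^ 2, Or.inl ⟨i, ?_, rfl⟩, pow_ne_zero _ (X_ne_zero i), ?_⟩
    -- The square of the first variable is not in the basis, but a one in first position already
    -- violates the ballot condition.
    · by_contra hi0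
      refine hball ⟨1, ?_⟩
      have : HasBit α 0 := ⟨by omega, by
        have : (⟨0, by omega⟩ : Fin n) = i := Fin.ext (by simp; omega)
        simp only [this, α, decide_eq_true_eq]
        omega⟩
      simp [prefixOnes, Nat.count_succ, this]
    · rw [degree_X_sq]
      exact Finsupp.single_le_iff.mpr hi2

theorem isGroebnerBasis_fullBasis [CharZero K] :
    IsGroebnerBasis MonomialOrder.lex (idealI K n) (fullBasis K n) := by
  have hsub : fullBasis K n ⊆ idealI K n := by
    rintro _ (⟨i, -, rfl⟩ | ⟨α, hα, rfl⟩)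
    · exact X_sq_mem_idealI i
    · obtain ⟨l, hl⟩ := isMCP_iff_exists_height.mp hα
      exact hl.gPoly_mem
  refine ⟨Set.Finite.union ?_ ?_, hsub, le_antisymm (Ideal.span_mono (Set.image_mono hsub)) ?_⟩
  · refine (Set.finite_range fun i : Fin n => (X i ^ 2 : MvPolynomial (Fin n) K)).subset ?_
    rintro _ ⟨i, -, rfl⟩
    exact ⟨i, rfl⟩
  · refine (Set.finite_range (gPoly K (n := n))).subset ?_
    rintro _ ⟨α, -, rfl⟩
    exact ⟨α, rfl⟩
  · rw [Ideal.span_le]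
    rintro _ ⟨p, hp, rfl⟩
    by_cases h0 : p = 0
    · simp [h0]
    · exact (monomial_mem_span_leadingTerm_iff
        (MonomialOrder.lex.leadingCoeff_ne_zero_iff.mpr h0)).mpr
          (exists_mem_fullBasis_degree_le hp h0)

variable {n} in
theorem not_single_two_le_expo {α : Fin n → Bool} {i : Fin n} :
    ¬ Finsupp.single i 2 ≤ expo α := by
  rw [Finsupp.single_le_iff, expo_apply]
  have := (α i).toNat_le
  omega

variable {n} in
-- Such an `α` would have a single one, so `l = 0` and this one sits at index `0`, whereas `i` is at
-- least `1`.
theorem IsMCPOfHeight.not_expo_le_single {α : Fin n → Bool} {l : ℕ} (h : IsMCPOfHeight α l)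
    {i : Fin n} (hi : 1 ≤ (i : ℕ)) : ¬ expo α ≤ Finsupp.single i 2 := by
  intro hle
  have hα : ∀ k : Fin n, α k = true → k = i := fun k hk => by
    by_contra hne
    simpa [hk, Finsupp.single_apply, Ne.symm hne] using hle k
  have hcard : ones α ≤ 1 :=
    Finset.card_le_one.mpr fun a ha b hb => by
      rw [hα a (by simpa using ha), hα b (by simpa using hb)]
  rw [h.ones_eq] at hcard
  obtain rfl : l = 0 := by omega
  have hlast := h.last
  obtain ⟨h0, hb⟩ : HasBit α 0 := by
    by_contra hb
    simp [prefixOnes, Nat.count_succ, hb] at hlast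
  rw [← hα _ hb] at hi
  simp at hi

theorem isReducedGroebnerBasis_fullBasis [CharZero K] :
    IsReducedGroebnerBasis MonomialOrder.lex (idealI K n) (fullBasis K n) := by
  classical
  refine ⟨isGroebnerBasis_fullBasis K n, ?_⟩
  rintro p (⟨i, hi, rfl⟩ | ⟨α, hα, rfl⟩)
  · refine ⟨by rw [X_pow_eq_monomial, MonomialOrder.leadingCoeff_monomial], fun e he => ?_⟩
    rw [X_pow_eq_monomial] at he
    obtain rfl : e = Finsupp.single i 2 := by simpa using support_monomial_subset he
    rw [monomial_mem_span_leadingTerm_iff one_ne_zero]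
    rintro ⟨q, ⟨⟨j, -, rfl⟩ | ⟨α, hα, rfl⟩, hne⟩, -, hle⟩
    · rw [degree_X_sq, Finsupp.single_le_iff, Finsupp.single_apply] at hle
      split_ifs at hle with hij
      · exact hne (by rw [hij]; rfl)
      · omega
    · obtain ⟨l, hl⟩ := isMCP_iff_exists_height.mp hα
      rw [hl.degree_gPoly] at hle
      exact hl.not_expo_le_single hi hle
  · obtain ⟨l, hl⟩ := isMCP_iff_exists_height.mp hα
    refine ⟨hl.leadingCoeff_gPoly, fun e he => ?_⟩
    obtain ⟨β, hβ, rfl⟩ := exists_of_mem_support_gPoly he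
    rw [monomial_mem_span_leadingTerm_iff one_ne_zero]
    rintro ⟨q, ⟨⟨j, -, rfl⟩ | ⟨α', hα', rfl⟩, hne⟩, -, hle⟩
    · rw [degree_X_sq] at hle
      exact not_single_two_le_expo hle
    · obtain ⟨l', hl'⟩ := isMCP_iff_exists_height.mp hα'
      rw [hl'.degree_gPoly, expo_le_expo_iff] at hle
      obtain ⟨hones, hpath⟩ := hl.mem_insert_pathsAbove.mp hβ
      exact hne (by rw [hl.eq_of_dvd hl' hones hpath hle]; rfl)

/-- The bound on `ones α` is automatic: the last one has index `2 * l < n`, and `ones α - 1 = l`. -/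
theorem stageBasis_eq_fullBasis : stageBasis K n (((n : ℤ) - 1) / 2) = fullBasis K n := by
  refine congrArg (tailSquares K n ∪ ·) (Set.ext fun f => exists_congr fun α => ?_)
  refine ⟨fun ⟨h1, _, h3⟩ => ⟨h1, h3⟩, fun ⟨h1, h3⟩ => ⟨h1, ?_, h3⟩⟩
  obtain ⟨l, hl⟩ := isMCP_iff_exists_height.mp h1
  have := hl.lt
  rw [hl.ones_eq]
  omega

end Basis

end CatalanGroebner

end

theorem theorem1p1 (K : Type*) [Field K] [CharZero K] (n : ℕ) (hn : 0 < n) :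
    (∀ G : Set (MvPolynomial (Fin n) K),
      CatalanGroebner.IsReducedGroebnerBasis MonomialOrder.lex (CatalanGroebner.idealI K n) G ↔
        G = CatalanGroebner.fullBasis K n) ∧
    (∀ G : Set (MvPolynomial (Fin n) K),
      CatalanGroebner.IsReducedGroebnerBasis MonomialOrder.lex (CatalanGroebner.idealI K n) G ↔
        G = CatalanGroebner.stageBasis K n (((n : ℤ) - 1) / 2)) := by
  have hfull := CatalanGroebner.isReducedGroebnerBasis_fullBasis K n
  rw [CatalanGroebner.stageBasis_eq_fullBasis, and_self]
  exact fun G => ⟨fun hG => hG.unique hfull, fun hG => hG ▸ hfull⟩
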